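/- Let $N\ge 1$ be an integer, $R\in(0,1]$ and $c,\alpha\ge 0$. Let $B_R$ be the open ball of radius $R$ centred at $0$ in $\mathbb{R}^N$, and let $u\in L^1_{\mathrm{loc}}(B_R\setminus\{0\})$ satisfy $u\ge 0$ almost everywhere in $B_R\setminus\{0\}$ and $$-\Delta u-c\,|x|^{-2}u\ \ge\ \alpha\,|x|^{-2}\bigl|\log|x|\bigr|^{-2}u\qquad\text{in }\mathcal D'(B_R\setminus\{0\}),$$ that is, $$-\int_{B_R}u\,\Delta\varphi\,dx-c\int_{B_R}|x|^{-2}u\,\varphi\,dx\ \ge\ \alpha\int_{B_R}|x|^{-2}\bigl|\log|x|\bigr|^{-2}u\,\varphi\,dx$$ for every nonnegative $\varphi\in C^\infty_c(B_R\setminus\{0\})$. (i) If $c>\frac{(N-2)^2}{4}$, then $u=0$ almost everywhere in $B_R\setminus\{0\}$. (ii) If $c=\frac{(N-2)^2}{4}$ and $\alpha>\frac14$, then $u=0$ almost everywhere in $B_R\setminus\{0\}$. -/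

import Mathlib

open MeasureTheory TopologicalSpace
open scoped Distributions

/-- The punctured open ball `B_R \ {0}` in `ℝ^N`, as an open set. -/
def puncturedBall (N : ℕ) (R : ℝ) : Opens (EuclideanSpace ℝ (Fin N)) :=
  ⟨Metric.ball 0 R \ {0}, Metric.isOpen_ball.sdiff isClosed_singleton⟩

/-- `u` is a distributional solution of
`-Δu - c |x|⁻² u ≥ α |x|⁻² |log |x||⁻² u` in `𝓓'(B_R \ {0})`: it belongs to
`L¹_loc(B_R \ {0})` and the inequality holds after integration against every nonnegative test
function `φ ∈ C_c^∞(B_R \ {0})`. -/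
def IsDistribSolution (N : ℕ) (R c α : ℝ) (u : EuclideanSpace ℝ (Fin N) → ℝ) : Prop :=
  LocallyIntegrableOn u (puncturedBall N R : Set (EuclideanSpace ℝ (Fin N))) volume ∧
  ∀ φ : 𝓓(puncturedBall N R, ℝ), (∀ x, 0 ≤ φ x) →
    -(∫ x in Metric.ball 0 R, u x * Laplacian.laplacian (φ : EuclideanSpace ℝ (Fin N) → ℝ) x)
      - c * (∫ x in Metric.ball 0 R, ‖x‖ ^ (-2 : ℤ) * u x * φ x)
    ≥ α * (∫ x in Metric.ball 0 R,
        ‖x‖ ^ (-2 : ℤ) * |Real.log ‖x‖| ^ (-2 : ℤ) * u x * φ x)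

/-! With `s = -log ‖x‖` and `φ = ‖x‖ ^ (-(N - 2) / 2) * g s`, the operator `Δ + c‖x‖⁻² + α‖x‖⁻²|log
‖x‖|⁻²` turns `φ` into a positive weight times `g'' + (c - (N - 2)² / 4 + α / s²) g`. If this is
nonnegative, and positive where `g > 0`, testing the inequality with `φ` forces `u = 0` almost
everywhere on `{g > 0}`. So it suffices to find such compactly supported bumps, positive at any
prescribed `s > -log R`.

For a constant potential `μ > 0` a wide bump works: it is convex near its ends, and in the middle `μ
k` outweighs `k''`. There is room, because `s` runs up to `∞` at the origin. In the critical case,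
`g = √s * k (log s)` turns the potential `α / s²` into the constant `α - 1 / 4`. -/

/-! ### Laplacians of functions of `‖x‖ ^ 2`. -/

open Filter Topology in
/-- The Laplacian of a function of `‖x‖ ^ 2`. -/
theorem laplacian_comp_norm_sq {N : ℕ} {H H₁ : ℝ → ℝ} {H₂ : ℝ} {x : EuclideanSpace ℝ (Fin N)}
    (h₁ : ∀ᶠ q in 𝓝 (‖x‖ ^ 2), HasDerivAt H (H₁ q) q) (h₂ : HasDerivAt H₁ H₂ (‖x‖ ^ 2)) :
    Laplacian.laplacian (fun y : EuclideanSpace ℝ (Fin N) => H (‖y‖ ^ 2)) x =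
      4 * ‖x‖ ^ 2 * H₂ + 2 * N * H₁ (‖x‖ ^ 2) := by
  obtain ⟨B, hB⟩ : ∃ B : EuclideanSpace ℝ (Fin N) →L[ℝ] EuclideanSpace ℝ (Fin N) →L[ℝ] ℝ,
      ∀ v w, B v w = inner ℝ v w := ⟨innerSL ℝ, fun _ _ => rfl⟩
  have hsq : ∀ y : EuclideanSpace ℝ (Fin N),
      HasFDerivAt (fun y : EuclideanSpace ℝ (Fin N) => ‖y‖ ^ 2) ((2 : ℝ) • B y) y := fun y => by
    refine (hasStrictFDerivAt_norm_sq y).hasFDerivAt.congr_fderiv ?_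
    ext w
    simp [hB, two_smul]
  have hcont : Tendsto (fun y : EuclideanSpace ℝ (Fin N) => ‖y‖ ^ 2) (𝓝 x) (𝓝 (‖x‖ ^ 2)) :=
    (continuous_norm.pow 2).tendsto x
  have hfd : fderiv ℝ (fun y : EuclideanSpace ℝ (Fin N) => H (‖y‖ ^ 2)) =ᶠ[𝓝 x]
      fun y => H₁ (‖y‖ ^ 2) • ((2 : ℝ) • B y) := by
    filter_upwards [hcont.eventually h₁] with y hy
    have := (hy.comp_hasFDerivAt y (hsq y)).fderiv
    rw [show (H ∘ fun y : EuclideanSpace ℝ (Fin N) => ‖y‖ ^ 2) =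
      fun y => H (‖y‖ ^ 2) from rfl] at this
    rw [this]
  have hsecond := ((h₂.comp_hasFDerivAt x (hsq x)).smul
    (B.hasFDerivAt.const_smul (2 : ℝ))).fderiv
  rw [InnerProductSpace.laplacian_eq_iteratedFDeriv_orthonormalBasis _
    (EuclideanSpace.basisFun (Fin N) ℝ)]
  have key : ∀ i : Fin N, iteratedFDeriv ℝ 2 (fun y : EuclideanSpace ℝ (Fin N) => H (‖y‖ ^ 2)) x
      ![EuclideanSpace.basisFun (Fin N) ℝ i, EuclideanSpace.basisFun (Fin N) ℝ i] =
      4 * H₂ * (x i) ^ 2 + 2 * H₁ (‖x‖ ^ 2) := by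
    intro i
    rw [iteratedFDeriv_two_apply, hfd.fderiv_eq]
    erw [hsecond]
    simp [EuclideanSpace.inner_single_right, hB]
    ring_nf
  simp_rw [key]
  rw [Finset.sum_add_distrib, ← Finset.mul_sum, ← EuclideanSpace.real_norm_sq_eq]
  simp
  ring

theorem continuous_laplacian {N : ℕ} {f : EuclideanSpace ℝ (Fin N) → ℝ} (hf : ContDiff ℝ 2 f) :
    Continuous (Laplacian.laplacian f) := by
  rw [InnerProductSpace.laplacian_eq_iteratedFDeriv_orthonormalBasis _
    (EuclideanSpace.basisFun (Fin N) ℝ)]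
  exact continuous_finsetSum _ fun i _ =>
    (ContinuousMultilinearMap.apply ℝ (fun _ : Fin 2 => EuclideanSpace ℝ (Fin N)) ℝ _).continuous.comp
      (hf.continuous_iteratedFDeriv (m := 2) le_rfl)

/-! ### One-dimensional bumps. -/

/-- For `y ≤ 0.42` the square term alone exceeds 2; beyond that the quartic does, and this fixes the
constant 65. -/
theorem six_mul_one_sub_sq_sub_two_add_pos {y : ℝ} (hy : 0 < y) :
    0 < 6 * (1 - y) ^ 2 - 2 + 65 * y ^ 4 := by
  by_cases h : y ≤ 0.42
  · have : 0 < y ^ 4 := by positivity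
    nlinarith
  · push Not at h
    have h2 : 0.176 < y ^ 2 := by nlinarith
    have h3 : 0.176 * 0.176 < y ^ 2 * y ^ 2 := by gcongr
    have h4 := sq_nonneg (1 - y)
    have h5 : y ^ 4 = y ^ 2 * y ^ 2 := by ring
    rw [h5]
    norm_num at h3
    linarith

/-- Valid also at `z ≤ 0`, where the glue function vanishes, so the bump's derivative formulas need
no case split at the edge of its support. -/
theorem hasDerivAt_expNegInvGlue (z : ℝ) :
    HasDerivAt expNegInvGlue (z⁻¹ ^ 2 * expNegInvGlue z) z := by
  simpa using expNegInvGlue.hasDerivAt_polynomial_eval_inv_mul 1 z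

theorem hasDerivAt_inv_sq_mul_expNegInvGlue (z : ℝ) :
    HasDerivAt (fun z => z⁻¹ ^ 2 * expNegInvGlue z)
      ((z⁻¹ ^ 4 - 2 * z⁻¹ ^ 3) * expNegInvGlue z) z := by
  have := expNegInvGlue.hasDerivAt_polynomial_eval_inv_mul (Polynomial.X ^ 2) z
  simp only [Polynomial.eval_pow, Polynomial.eval_X] at this
  refine this.congr_deriv ?_
  simp
  left
  ring

/-- This is `k'' + μ k` for `k = exp (-1 / y)`, `y = 1 - τ²`, with `τ` affine of slope `1 / L`.
Factoring out `k / (L² y⁴)` leaves `6 (1 - y)² - 2 + μ L² y⁴`. -/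
theorem expNegInvGlue_one_sub_sq_deriv_add_mul_pos {μ L τ y : ℝ} (hL : 0 < L)
    (hμL : 65 < μ * L ^ 2) (hτy : τ ^ 2 = 1 - y) (hy : 0 < y) :
    0 < (y⁻¹ ^ 4 - 2 * y⁻¹ ^ 3) * expNegInvGlue y * (2 * τ / L) ^ 2 -
      y⁻¹ ^ 2 * expNegInvGlue y * (2 / L ^ 2) + μ * expNegInvGlue y := by
  have hF : 0 < expNegInvGlue y := expNegInvGlue.pos_of_pos hy
  have hτL : (2 * τ / L) ^ 2 = 4 * (1 - y) / L ^ 2 := by rw [div_pow, mul_pow, hτy]; ring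
  rw [hτL]
  generalize expNegInvGlue y = F at hF ⊢
  have : (y⁻¹ ^ 4 - 2 * y⁻¹ ^ 3) * F * (4 * (1 - y) / L ^ 2) - y⁻¹ ^ 2 * F * (2 / L ^ 2) + μ * F =
      F / (L ^ 2 * y ^ 4) * (6 * (1 - y) ^ 2 - 2 + μ * L ^ 2 * y ^ 4) := by
    field_simp
    ring
  rw [this]
  refine mul_pos (by positivity) ?_
  have : 65 * y ^ 4 < μ * L ^ 2 * y ^ 4 := by gcongr
  linarith [six_mul_one_sub_sq_sub_two_add_pos hy]

/-- A nonnegative smooth bump `k`, supported to the right of `a` and positive at `t`, which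
satisfies `k'' + μ k ≥ 0`, strictly where `k > 0`. -/
theorem exists_bump_deriv_add_mul_nonneg {μ a t : ℝ} (hμ : 0 < μ) (hat : a < t) :
    ∃ (k k₁ k₂ : ℝ → ℝ) (a' b : ℝ), a < a' ∧ ContDiff ℝ (⊤ : ℕ∞) k ∧
      (∀ s, HasDerivAt k (k₁ s) s) ∧ (∀ s, HasDerivAt k₁ (k₂ s) s) ∧ (∀ s, 0 ≤ k s) ∧
      (∀ s, s ∉ Set.Icc a' b → k s = 0) ∧ 0 < k t ∧ (∀ s, 0 ≤ k₂ s + μ * k s) ∧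
      ∀ s, 0 < k s → 0 < k₂ s + μ * k s := by
  obtain ⟨a', haa', hat'⟩ := exists_between hat
  -- The half-width `L` exceeds `t - a'`, which puts `t` in the left half of the support; `L > 1`
  -- and `μ L > 65` give `μ L² > 65`.
  obtain ⟨L, hL⟩ : ∃ L, L = (t - a') + 65 / μ + 1 := ⟨_, rfl⟩
  have h65 : 0 < 65 / μ := by positivity
  have hL1 : 1 < L := by linarith
  have hL0 : 0 < L := by linarith
  have hμL : 65 < μ * L ^ 2 := by
    have h1 : 65 < μ * L := by
      have : μ * (65 / μ) = 65 := by field_simp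
      nlinarith
    nlinarith
  obtain ⟨τ, hτd⟩ : ∃ τ : ℝ → ℝ, τ = fun s => (s - (a' + L)) / L := ⟨_, rfl⟩
  obtain ⟨y, hyd⟩ : ∃ y : ℝ → ℝ, y = fun s => 1 - τ s ^ 2 := ⟨_, rfl⟩
  have hτs : ∀ s, τ s = (s - (a' + L)) / L := fun s => by rw [hτd]
  have hys : ∀ s, y s = 1 - τ s ^ 2 := fun s => by rw [hyd]
  have hτ : ∀ s, HasDerivAt τ (1 / L) s := fun s => by
    rw [hτd]
    exact ((hasDerivAt_id s).sub_const (a' + L)).div_const L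
  have hy : ∀ s, HasDerivAt y (-(2 * τ s / L)) s := fun s => by
    rw [hyd]
    refine HasDerivAt.congr_deriv (((hτ s).pow 2).const_sub 1) ?_
    simp
    ring
  have hpos : ∀ s, 0 < y s → _ := fun s hs =>
    expNegInvGlue_one_sub_sq_deriv_add_mul_pos hL0 hμL (by rw [hys]; ring : τ s ^ 2 = 1 - y s) hs
  refine ⟨fun s => expNegInvGlue (y s),
    fun s => (y s)⁻¹ ^ 2 * expNegInvGlue (y s) * (-(2 * τ s / L)),
    fun s => ((y s)⁻¹ ^ 4 - 2 * (y s)⁻¹ ^ 3) * expNegInvGlue (y s) * (2 * τ s / L) ^ 2 -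
      (y s)⁻¹ ^ 2 * expNegInvGlue (y s) * (2 / L ^ 2), a', a' + 2 * L,
    haa', ?_, fun s => (hasDerivAt_expNegInvGlue _).comp s (hy s), ?_,
    fun s => expNegInvGlue.nonneg _, ?_, ?_, ?_, ?_⟩
  · refine expNegInvGlue.contDiff.comp ?_
    rw [hyd, hτd]
    exact contDiff_const.sub (((contDiff_id.sub contDiff_const).div_const L).pow 2)
  · intro s
    have h := ((hasDerivAt_inv_sq_mul_expNegInvGlue (y s)).comp s (hy s)).mul
      (((hτ s).const_mul 2).div_const L).neg
    refine HasDerivAt.congr_deriv h ?_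
    simp only [Function.comp, Pi.neg_apply]
    ring
  · intro s hs
    refine expNegInvGlue.zero_of_nonpos ?_
    have : 1 ≤ τ s ^ 2 := by
      rw [Set.mem_Icc, not_and_or, not_le, not_le] at hs
      rcases hs with hs | hs
      · have : τ s ≤ -1 := by rw [hτs, div_le_iff₀ hL0]; linarith
        nlinarith
      · have : 1 ≤ τ s := by rw [hτs, le_div_iff₀ hL0]; linarith
        nlinarith
    rw [hys]
    linarith
  · refine expNegInvGlue.pos_of_pos ?_
    have h1 : -1 < τ t := by rw [hτs, lt_div_iff₀ hL0]; linarith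
    have h2 : τ t < 0 := by rw [hτs]; exact div_neg_of_neg_of_pos (by linarith) hL0
    rw [hys]
    nlinarith
  · intro s
    rcases lt_or_ge 0 (y s) with h | h
    · exact (hpos s h).le
    · simp [expNegInvGlue.zero_of_nonpos h]
  · intro s hs
    exact hpos s (by_contra fun h => hs.ne' (expNegInvGlue.zero_of_nonpos (not_lt.1 h)))

open Filter Topology in
/-- A nonnegative smooth bump `g`, supported to the right of `T ≥ 0` and positive at `t`, which
satisfies `g'' + α s⁻² g ≥ 0` for `s > 0`, strictly where `g > 0`. -/
theorem exists_bump_deriv_add_inv_sq_mul_nonneg {α T t : ℝ} (hα : 1 / 4 < α) (hT : 0 ≤ T)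
    (ht : T < t) :
    ∃ (g g₁ g₂ : ℝ → ℝ) (a b : ℝ), T < a ∧ ContDiff ℝ (⊤ : ℕ∞) g ∧
      (∀ s, 0 < s → HasDerivAt g (g₁ s) s) ∧ (∀ s, 0 < s → HasDerivAt g₁ (g₂ s) s) ∧
      (∀ s, 0 ≤ g s) ∧ (∀ s, s ∉ Set.Icc a b → g s = 0) ∧ 0 < g t ∧
      (∀ s, 0 < s → 0 ≤ g₂ s + α / s ^ 2 * g s) ∧
      ∀ s, 0 < s → 0 < g s → 0 < g₂ s + α / s ^ 2 * g s := by
  obtain ⟨T', hTT', hT't⟩ := exists_between ht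
  have hT'0 : 0 < T' := by linarith
  have ht0 : 0 < t := by linarith
  obtain ⟨k, k₁, k₂, a, b, ha, hk, hk₁, hk₂, hk0, hksupp, hkt, hkn, hkp⟩ :=
    exists_bump_deriv_add_mul_nonneg (μ := α - 1 / 4) (by linarith)
      (Real.log_lt_log hT'0 hT't)
  have hsupp : ∀ s, s ∉ Set.Icc (Real.exp a) (Real.exp b) → √s * k (Real.log s) = 0 := by
    intro s hs
    rcases le_or_gt s 0 with h | h
    · simp [Real.sqrt_eq_zero_of_nonpos h]
    · rw [hksupp, mul_zero]
      rwa [Set.mem_Icc, Real.le_log_iff_exp_le h, Real.log_le_iff_le_exp h]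
  -- The factor `√s` cancels the first-order term produced by `log s`, at the cost of `-1 / 4`.
  have heq : ∀ s, 0 < s → (k₂ (Real.log s) - k (Real.log s) / 4) / (s * √s) +
      α / s ^ 2 * (√s * k (Real.log s)) =
      (k₂ (Real.log s) + (α - 1 / 4) * k (Real.log s)) / (s * √s) := by
    intro s hs
    have hs' : 0 < √s := Real.sqrt_pos.2 hs
    obtain ⟨r, hr⟩ : ∃ r, r = √s := ⟨_, rfl⟩
    have h2 : s = r ^ 2 := by rw [hr, Real.sq_sqrt hs.le]
    have hr0 : 0 < r := hr ▸ hs'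
    generalize hl : Real.log s = l
    rw [← hr, h2]
    field_simp
    ring
  refine ⟨fun s => √s * k (Real.log s),
    fun s => (k (Real.log s) / 2 + k₁ (Real.log s)) / √s,
    fun s => (k₂ (Real.log s) - k (Real.log s) / 4) / (s * √s), Real.exp a, Real.exp b, ?_, ?_,
    ?_, ?_, fun s => mul_nonneg (Real.sqrt_nonneg _) (hk0 _), hsupp,
    mul_pos (Real.sqrt_pos.2 ht0) hkt, ?_, ?_⟩
  · rw [Real.log_lt_iff_lt_exp hT'0] at ha
    linarith
  · rw [contDiff_iff_contDiffAt]
    intro s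
    rcases le_or_gt s 0 with h | h
    -- The singularities of `√s` and `log s` at 0 are harmless: the product vanishes for `s < exp
    -- a`.
    · refine (contDiffAt_const (c := (0 : ℝ))).congr_of_eventuallyEq ?_
      filter_upwards [gt_mem_nhds (h.trans_lt (Real.exp_pos a))] with r hr
      exact hsupp r fun h => absurd h.1 (not_le.2 hr)
    · exact (Real.contDiffAt_sqrt h.ne').mul
        (hk.contDiffAt.comp s (Real.contDiffAt_log.2 h.ne'))
  · intro s hs
    refine HasDerivAt.congr_deriv ((Real.hasDerivAt_sqrt hs.ne').mul
      ((hk₁ (Real.log s)).comp s (Real.hasDerivAt_log hs.ne'))) ?_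
    obtain ⟨r, hr⟩ : ∃ r, r = √s := ⟨_, rfl⟩
    have h2 : s = r ^ 2 := by rw [hr, Real.sq_sqrt hs.le]
    have hr0 : 0 < r := hr ▸ Real.sqrt_pos.2 hs
    dsimp only
    generalize hl : Real.log s = l
    rw [← hr, h2]
    field_simp
  · intro s hs
    have hs' : 0 < √s := Real.sqrt_pos.2 hs
    refine HasDerivAt.congr_deriv (((((hk₁ (Real.log s)).comp s
      (Real.hasDerivAt_log hs.ne')).div_const 2).add ((hk₂ (Real.log s)).comp s (Real.hasDerivAt_log hs.ne'))).div
        (Real.hasDerivAt_sqrt hs.ne') hs'.ne') ?_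
    rw [Real.sq_sqrt hs.le]
    simp only [Function.comp, Pi.add_apply]
    obtain ⟨r, hr⟩ : ∃ r, r = √s := ⟨_, rfl⟩
    have h2 : s = r ^ 2 := by rw [hr, Real.sq_sqrt hs.le]
    have hr0 : 0 < r := hr ▸ hs'
    generalize hl : Real.log s = l
    rw [← hr, h2]
    field_simp
    ring
  · intro s hs
    rw [heq s hs]
    exact div_nonneg (hkn _) (by positivity)
  · intro s hs hg
    rw [heq s hs]
    have : 0 < √s := Real.sqrt_pos.2 hs
    exact div_pos (hkp _ (pos_of_mul_pos_right hg this.le)) (by positivity)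

/-! ### Radial test functions on the punctured ball. -/

open Filter Topology Laplacian in
/-- Radial test functions: if `g` is a nonnegative bump supported in `(T, ∞)`, `T = -log R`, then
`‖x‖ ^ (-(N - 2) / 2) * g (-log ‖x‖)` is a test function on the punctured ball of radius `R`. -/
theorem exists_testFunction_radial {N : ℕ} {R : ℝ} (hR : 0 < R) (hR1 : R ≤ 1)
    {g g₁ g₂ : ℝ → ℝ} {a b : ℝ} (ha : -Real.log R < a) (hg : ContDiff ℝ (⊤ : ℕ∞) g)
    (hg₁ : ∀ s, 0 < s → HasDerivAt g (g₁ s) s) (hg₂ : ∀ s, 0 < s → HasDerivAt g₁ (g₂ s) s)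
    (hsupp : ∀ s, s ∉ Set.Icc a b → g s = 0) :
    ∃ φ : 𝓓(puncturedBall N R, ℝ),
      (∀ x, φ x = Real.exp (((N : ℝ) - 2) / 2 * -Real.log ‖x‖) * g (-Real.log ‖x‖)) ∧
      ∀ x ∈ puncturedBall N R, Laplacian.laplacian (φ : EuclideanSpace ℝ (Fin N) → ℝ) x =
        Real.exp (((N : ℝ) - 2) / 2 * -Real.log ‖x‖) / ‖x‖ ^ 2 *
          (g₂ (-Real.log ‖x‖) - ((N : ℝ) - 2) ^ 2 / 4 * g (-Real.log ‖x‖)) := by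
  have hlogR : Real.log R ≤ 0 := Real.log_nonpos hR.le hR1
  have ha0 : 0 < a := by linarith
  set κ : ℝ := ((N : ℝ) - 2) / 2 with hκ
  set f : EuclideanSpace ℝ (Fin N) → ℝ :=
    fun x => Real.exp (κ * -Real.log ‖x‖) * g (-Real.log ‖x‖) with hf
  set K : Set (EuclideanSpace ℝ (Fin N)) :=
    Metric.closedBall 0 (Real.exp (-a)) \ Metric.ball 0 (Real.exp (-b)) with hK
  have hKc : IsCompact K := (isCompact_closedBall _ _).diff Metric.isOpen_ball
  have hfK : ∀ x, x ∉ K → f x = 0 := by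
    intro x hx
    simp only [hf]
    rcases eq_or_ne x 0 with rfl | h0
    · rw [hsupp, mul_zero]
      -- At the origin `log 0 = 0` by convention, and `0 < a` lies outside the support of `g`.
      simp only [norm_zero, Real.log_zero, neg_zero]
      exact fun h => absurd h.1 (not_le.2 ha0)
    · rw [hsupp, mul_zero]
      contrapose! hx
      have hn := norm_pos_iff.2 h0
      rw [hK, Set.mem_sdiff, mem_closedBall_zero_iff, mem_ball_zero_iff, not_lt,
        ← Real.log_le_iff_le_exp hn, ← Real.le_log_iff_exp_le hn]
      constructor <;> linarith [hx.1, hx.2]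
  have hKΩ : K ⊆ puncturedBall N R := by
    intro x hx
    rw [hK, Set.mem_sdiff, mem_closedBall_zero_iff, mem_ball_zero_iff, not_lt] at hx
    refine ⟨mem_ball_zero_iff.2 (hx.1.trans_lt ?_), ?_⟩
    · rw [← Real.lt_log_iff_exp_lt hR]; linarith
    · change x ≠ 0
      rw [← norm_pos_iff]
      exact (Real.exp_pos _).trans_le hx.2
  have hts : tsupport f ⊆ K :=
    closure_minimal (fun x hx => by_contra fun h => hx (hfK x h)) hKc.isClosed
  have hsmooth : ContDiff ℝ (⊤ : ℕ∞) f := by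
    rw [contDiff_iff_contDiffAt]
    intro x
    by_cases hx : x ∈ K
    · have h0 : x ≠ 0 := (hKΩ hx).2
      have hl : ContDiffAt ℝ (⊤ : ℕ∞)
          (fun y : EuclideanSpace ℝ (Fin N) => -Real.log ‖y‖) x :=
        ((contDiffAt_norm ℝ h0).log (norm_ne_zero_iff.2 h0)).neg
      exact (contDiffAt_const.mul hl).exp.mul (hg.contDiffAt.comp x hl)
    · refine (contDiffAt_const (c := (0 : ℝ))).congr_of_eventuallyEq ?_
      filter_upwards [hKc.isClosed.isOpen_compl.mem_nhds hx] with y hy using hfK y hy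
  refine ⟨⟨f, hsmooth, hKc.of_isClosed_subset (isClosed_tsupport f) hts, hts.trans hKΩ⟩,
    fun x => rfl, ?_⟩
  intro x hx
  have hx0 : 0 < ‖x‖ := norm_pos_iff.2 hx.2
  have hxR : ‖x‖ < 1 := (mem_ball_zero_iff.1 hx.1).trans_le hR1
  -- In the variable `q = ‖x‖ ^ 2`, `s = -log q / 2`.
  let H : ℝ → ℝ := fun q => Real.exp (κ * (-Real.log q / 2)) * g (-Real.log q / 2)
  let H₁ : ℝ → ℝ := fun q => Real.exp (κ * (-Real.log q / 2)) *
    (κ * g (-Real.log q / 2) + g₁ (-Real.log q / 2)) * (-(1 / (2 * q)))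
  have hlog : ∀ y : EuclideanSpace ℝ (Fin N), -Real.log (‖y‖ ^ 2) / 2 = -Real.log ‖y‖ := by
    intro y; rw [Real.log_pow]; push_cast; ring
  have hfH : f = fun y => H (‖y‖ ^ 2) := by
    funext y; simp only [hf, H, hlog]
  have hpos : ∀ q ∈ Set.Ioo (0 : ℝ) 1, 0 < -Real.log q / 2 := fun q hq => by
    have := Real.log_neg hq.1 hq.2
    linarith
  have hl : ∀ q ∈ Set.Ioo (0 : ℝ) 1,
      HasDerivAt (fun q => -Real.log q / 2) (-(1 / (2 * q))) q := fun q hq =>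
    ((Real.hasDerivAt_log hq.1.ne').neg.div_const 2).congr_deriv (by ring)
  have hexp : ∀ q ∈ Set.Ioo (0 : ℝ) 1, HasDerivAt (fun q => Real.exp (κ * (-Real.log q / 2)))
      (Real.exp (κ * (-Real.log q / 2)) * (κ * -(1 / (2 * q)))) q := fun q hq =>
    ((hl q hq).const_mul κ).exp
  have hH : ∀ q ∈ Set.Ioo (0 : ℝ) 1, HasDerivAt H (H₁ q) q := fun q hq => by
    refine HasDerivAt.congr_deriv ((hexp q hq).mul ((hg₁ _ (hpos q hq)).comp q (hl q hq))) ?_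
    simp only [H₁]
    ring
  have hxq : ‖x‖ ^ 2 ∈ Set.Ioo (0 : ℝ) 1 := ⟨by positivity, by nlinarith⟩
  have hinv : HasDerivAt (fun q : ℝ => -(1 / (2 * q))) (1 / (2 * (‖x‖ ^ 2) ^ 2)) (‖x‖ ^ 2) := by
    refine HasDerivAt.congr_deriv
      (((hasDerivAt_const (‖x‖ ^ 2) (1 : ℝ)).div ((hasDerivAt_id (‖x‖ ^ 2)).const_mul 2)
        (by simpa using hx0.ne')).neg) ?_
    simp only [id]
    field_simp
    ring
  have hinner : ∀ q ∈ Set.Ioo (0 : ℝ) 1,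
      HasDerivAt (fun q => κ * g (-Real.log q / 2) + g₁ (-Real.log q / 2))
        ((κ * g₁ (-Real.log q / 2) + g₂ (-Real.log q / 2)) * (-(1 / (2 * q)))) q := fun q hq => by
    refine HasDerivAt.congr_deriv ((((hg₁ _ (hpos q hq)).comp q (hl q hq)).const_mul κ).add
      ((hg₂ _ (hpos q hq)).comp q (hl q hq))) ?_
    ring
  have hH₁ := ((hexp _ hxq).mul (hinner _ hxq)).mul hinv
  have := laplacian_comp_norm_sq (x := x) (H := H) (H₁ := H₁)
    (by filter_upwards [isOpen_Ioo.mem_nhds hxq] with q hq using hH q hq) hH₁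
  change Laplacian.laplacian f x = _
  rw [hfH, this]
  simp only [H₁, Pi.mul_apply, hlog]
  generalize Real.exp (κ * -Real.log ‖x‖) = e
  have hN : (N : ℝ) = 2 * κ + 2 := by rw [hκ]; ring
  rw [hN]
  field_simp
  ring

/-! ### Testing the inequality. -/

/-- A nonnegative `u` which satisfies the differential inequality vanishes wherever a radial test
function with `g'' + (c - (N - 2)² / 4 + α / s²) g > 0` is positive. -/
theorem ae_eq_zero_of_radial_subsolution {N : ℕ} (hN : 1 ≤ N) {R c α : ℝ} (hR : 0 < R)
    (hR1 : R ≤ 1) {u : EuclideanSpace ℝ (Fin N) → ℝ}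
    (hu0 : ∀ᵐ x ∂volume.restrict
      (puncturedBall N R : Set (EuclideanSpace ℝ (Fin N))), 0 ≤ u x)
    (hu : IsDistribSolution N R c α u)
    {g g₁ g₂ : ℝ → ℝ} {a b : ℝ} (ha : -Real.log R < a) (hg : ContDiff ℝ (⊤ : ℕ∞) g)
    (hg₁ : ∀ s, 0 < s → HasDerivAt g (g₁ s) s) (hg₂ : ∀ s, 0 < s → HasDerivAt g₁ (g₂ s) s)
    (hg0 : ∀ s, 0 ≤ g s) (hsupp : ∀ s, s ∉ Set.Icc a b → g s = 0)
    (hnn : ∀ s, 0 < s → 0 ≤ g₂ s + (c - ((N : ℝ) - 2) ^ 2 / 4 + α / s ^ 2) * g s)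
    (hpos : ∀ s, 0 < s → 0 < g s →
      0 < g₂ s + (c - ((N : ℝ) - 2) ^ 2 / 4 + α / s ^ 2) * g s) :
    ∀ᵐ x ∂volume.restrict (puncturedBall N R : Set (EuclideanSpace ℝ (Fin N))),
      0 < g (-Real.log ‖x‖) → u x = 0 := by
  obtain ⟨φ, hφ, hΔ⟩ := exists_testFunction_radial (N := N) hR hR1 ha hg hg₁ hg₂ hsupp
  have hφ0 : ∀ x, 0 ≤ φ x := fun x => by rw [hφ]; exact mul_nonneg (Real.exp_pos _).le (hg0 _)
  have hineq := hu.2 φ hφ0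
  -- In positive dimension the origin is a null set, so the ball and the punctured ball give the
  -- same integrals.
  have : Nonempty (Fin N) := ⟨⟨0, hN⟩⟩
  have hball : volume.restrict (Metric.ball (0 : EuclideanSpace ℝ (Fin N)) R) =
      volume.restrict (puncturedBall N R : Set (EuclideanSpace ℝ (Fin N))) :=
    (Measure.restrict_congr_set (sdiff_null_ae_eq_self (measure_singleton 0))).symm
  rw [hball] at hineq
  have hmeas : MeasurableSet (puncturedBall N R : Set (EuclideanSpace ℝ (Fin N))) :=
    (puncturedBall N R).isOpen.measurableSet
  have hint : ∀ w : EuclideanSpace ℝ (Fin N) → ℝ,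
      ContinuousOn w (puncturedBall N R) → (∀ x, x ∉ tsupport φ → w x = 0) →
      IntegrableOn (fun x => u x * w x) (puncturedBall N R) volume := by
    intro w hw hw0
    have h1 : IntegrableOn (fun x => u x * w x) (tsupport φ) volume :=
      (hu.1.integrableOn_compact_subset φ.tsupport_subset φ.hasCompactSupport).mul_continuousOn
        (hw.mono φ.tsupport_subset) φ.hasCompactSupport
    exact h1.of_forall_sdiff_eq_zero hmeas fun x hx => by rw [hw0 x hx.2, mul_zero]
  have hne : ∀ x ∈ (puncturedBall N R : Set (EuclideanSpace ℝ (Fin N))), 0 < ‖x‖ :=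
    fun x hx => norm_pos_iff.2 hx.2
  have hlogpos : ∀ x ∈ (puncturedBall N R : Set (EuclideanSpace ℝ (Fin N))),
      0 < -Real.log ‖x‖ := fun x hx => by
    have := Real.log_neg (hne x hx) ((mem_ball_zero_iff.1 hx.1).trans_le hR1)
    linarith
  have hI₁ := hint (Laplacian.laplacian (φ : EuclideanSpace ℝ (Fin N) → ℝ))
    (continuous_laplacian (φ.contDiff.of_le (WithTop.coe_le_coe.2 le_top))).continuousOn (by
      intro x hx
      have : (φ : EuclideanSpace ℝ (Fin N) → ℝ) =ᶠ[nhds x] fun _ => 0 := by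
        filter_upwards [(isClosed_tsupport φ).isOpen_compl.mem_nhds hx] with y hy
          using image_eq_zero_of_notMem_tsupport hy
      rw [(InnerProductSpace.laplacian_congr_nhds this).eq_of_nhds]
      simp)
  have hcn : ContinuousOn (fun x : EuclideanSpace ℝ (Fin N) => ‖x‖ ^ (-2 : ℤ))
      (puncturedBall N R) := fun x hx =>
    (continuous_norm.continuousAt.zpow₀ _ (Or.inl (hne x hx).ne')).continuousWithinAt
  have hcl : ContinuousOn (fun x : EuclideanSpace ℝ (Fin N) => |Real.log ‖x‖| ^ (-2 : ℤ))
      (puncturedBall N R) := fun x hx =>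
    (((Real.continuousAt_log (hne x hx).ne').comp continuous_norm.continuousAt).abs.zpow₀ _
      (Or.inl (abs_pos.2 (by linarith [hlogpos x hx] : Real.log ‖x‖ ≠ 0)).ne')).continuousWithinAt
  have hI₂ := hint (fun x => ‖x‖ ^ (-2 : ℤ) * φ x) (hcn.mul φ.continuous.continuousOn)
    fun x hx => by rw [image_eq_zero_of_notMem_tsupport hx, mul_zero]
  have hI₃ := hint (fun x => ‖x‖ ^ (-2 : ℤ) * |Real.log ‖x‖| ^ (-2 : ℤ) * φ x)
    ((hcn.mul hcl).mul φ.continuous.continuousOn)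
    fun x hx => by rw [image_eq_zero_of_notMem_tsupport hx, mul_zero]
  have hform : ∀ x ∈ (puncturedBall N R : Set (EuclideanSpace ℝ (Fin N))),
      u x * Laplacian.laplacian (φ : EuclideanSpace ℝ (Fin N) → ℝ) x + (c * (u x * (‖x‖ ^ (-2 : ℤ) * φ x)) +
        α * (u x * (‖x‖ ^ (-2 : ℤ) * |Real.log ‖x‖| ^ (-2 : ℤ) * φ x))) =
      u x * (Real.exp (((N : ℝ) - 2) / 2 * -Real.log ‖x‖) / ‖x‖ ^ 2 *
        (g₂ (-Real.log ‖x‖) + (c - ((N : ℝ) - 2) ^ 2 / 4 + α / (-Real.log ‖x‖) ^ 2) *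
          g (-Real.log ‖x‖))) := by
    intro x hx
    have habs : |Real.log ‖x‖| = -Real.log ‖x‖ := abs_of_neg (by linarith [hlogpos x hx])
    rw [hΔ x hx, hφ, habs, zpow_neg, zpow_neg]
    norm_cast
    simp only [div_eq_mul_inv]
    ring
  have hI := hI₁.add ((hI₂.const_mul c).add (hI₃.const_mul α))
  have hae0 : ∀ᵐ x ∂volume.restrict (puncturedBall N R : Set (EuclideanSpace ℝ (Fin N))),
      0 ≤ u x * Laplacian.laplacian (φ : EuclideanSpace ℝ (Fin N) → ℝ) x + (c * (u x * (‖x‖ ^ (-2 : ℤ) * φ x)) +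
        α * (u x * (‖x‖ ^ (-2 : ℤ) * |Real.log ‖x‖| ^ (-2 : ℤ) * φ x))) := by
    filter_upwards [hu0, ae_restrict_mem hmeas] with x hux hx
    rw [hform x hx]
    exact mul_nonneg hux (mul_nonneg (by positivity) (hnn _ (hlogpos x hx)))
  have hle : ∫ x in (puncturedBall N R : Set (EuclideanSpace ℝ (Fin N))),
      (u x * Laplacian.laplacian (φ : EuclideanSpace ℝ (Fin N) → ℝ) x + (c * (u x * (‖x‖ ^ (-2 : ℤ) * φ x)) +
        α * (u x * (‖x‖ ^ (-2 : ℤ) * |Real.log ‖x‖| ^ (-2 : ℤ) * φ x)))) ≤ 0 := by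
    have e1 := integral_add hI₁ ((hI₂.const_mul c).add (hI₃.const_mul α))
    have e2 := integral_add (hI₂.const_mul c) (hI₃.const_mul α)
    simp only [Pi.add_apply] at e1 e2
    rw [e1, e2, integral_const_mul, integral_const_mul]
    have s2 : ∀ x, u x * (‖x‖ ^ (-2 : ℤ) * φ x) = ‖x‖ ^ (-2 : ℤ) * u x * φ x := fun x => by ring
    have s3 : ∀ x, u x * (‖x‖ ^ (-2 : ℤ) * |Real.log ‖x‖| ^ (-2 : ℤ) * φ x) =
        ‖x‖ ^ (-2 : ℤ) * |Real.log ‖x‖| ^ (-2 : ℤ) * u x * φ x := fun x => by ring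
    simp_rw [s2, s3]
    linarith
  -- A nonnegative integrand with nonpositive integral vanishes almost everywhere.
  have hzero := (integral_eq_zero_iff_of_nonneg_ae hae0 hI).1
    (le_antisymm hle (integral_nonneg_of_ae hae0))
  filter_upwards [hzero, ae_restrict_mem hmeas] with x hx hxm hgx
  rw [hform x hxm] at hx
  refine (mul_eq_zero.1 hx).resolve_right (ne_of_gt ?_)
  have := hne x hxm
  exact mul_pos (by positivity) (hpos _ (hlogpos x hxm) hgx)

/-! ### From local vanishing to the two cases. -/

theorem mainTheorem8 (N : ℕ) (hN : 1 ≤ N) (R : ℝ) (hR : 0 < R) (hR1 : R ≤ 1)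
    (c α : ℝ) (hc : 0 ≤ c) (hα : 0 ≤ α)
    (u : EuclideanSpace ℝ (Fin N) → ℝ)
    (hu0 : ∀ᵐ x ∂volume.restrict
      (puncturedBall N R : Set (EuclideanSpace ℝ (Fin N))), 0 ≤ u x)
    (hu : IsDistribSolution N R c α u) :
    (c > ((N : ℝ) - 2) ^ 2 / 4 →
      ∀ᵐ x ∂volume.restrict
        (puncturedBall N R : Set (EuclideanSpace ℝ (Fin N))), u x = 0) ∧
    (c = ((N : ℝ) - 2) ^ 2 / 4 → α > 1 / 4 →
      ∀ᵐ x ∂volume.restrict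
        (puncturedBall N R : Set (EuclideanSpace ℝ (Fin N))), u x = 0) := by
  have hmeas : MeasurableSet (puncturedBall N R : Set (EuclideanSpace ℝ (Fin N))) :=
    (puncturedBall N R).isOpen.measurableSet
  have hlogR : 0 ≤ -Real.log R := neg_nonneg.2 (Real.log_nonpos hR.le hR1)
  have hlog : ∀ x ∈ (puncturedBall N R : Set (EuclideanSpace ℝ (Fin N))),
      -Real.log R < -Real.log ‖x‖ := fun x hx =>
    neg_lt_neg (Real.log_lt_log (norm_pos_iff.2 hx.2) (mem_ball_zero_iff.1 hx.1))
  have hlocal : (∀ t, -Real.log R < t → ∃ g : ℝ → ℝ, Continuous g ∧ 0 < g t ∧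
      ∀ᵐ x ∂volume.restrict (puncturedBall N R : Set (EuclideanSpace ℝ (Fin N))),
        0 < g (-Real.log ‖x‖) → u x = 0) →
      ∀ᵐ x ∂volume.restrict (puncturedBall N R : Set (EuclideanSpace ℝ (Fin N))), u x = 0 := by
    intro h
    rw [ae_restrict_iff' hmeas, ae_iff]
    -- Each bump is positive on a neighbourhood of its point, and a locally null set is null.
    refine measure_null_of_locally_null _ fun x hx => ?_
    simp only [Set.mem_ofPred_eq, Classical.not_imp] at hx
    obtain ⟨g, hgc, hgx, hgu⟩ := h _ (hlog x hx.1)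
    have hnhds : ∀ᶠ y in nhds x, 0 < g (-Real.log ‖y‖) := by
      have hx0 : ‖x‖ ≠ 0 := norm_ne_zero_iff.2 hx.1.2
      exact (hgc.continuousAt.comp
        ((Real.continuousAt_log hx0).comp continuous_norm.continuousAt).neg).eventually
          (lt_mem_nhds hgx)
    refine ⟨{y | ¬ (y ∈ (puncturedBall N R : Set (EuclideanSpace ℝ (Fin N))) → u y = 0)} ∩
      {y | 0 < g (-Real.log ‖y‖)}, Filter.inter_mem self_mem_nhdsWithin
        (mem_nhdsWithin_of_mem_nhds hnhds), ?_⟩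
    rw [ae_restrict_iff' hmeas, ae_iff] at hgu
    refine measure_mono_null (fun y hy => ?_) hgu
    have h1 := hy.1
    have h2 := hy.2
    simp only [Set.mem_ofPred_eq, Classical.not_imp] at h1 h2 ⊢
    exact ⟨h1.1, h2, h1.2⟩
  constructor
  · intro hc'
    refine hlocal fun t ht => ?_
    obtain ⟨k, k₁, k₂, a, b, ha, hk, hk₁, hk₂, hk0, hksupp, hkt, hkn, hkp⟩ :=
      exists_bump_deriv_add_mul_nonneg (sub_pos.2 hc') ht
    -- Above the critical `c` the logarithmic term only helps, so the constant-potential bump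
    -- suffices.
    have hαk : ∀ s, 0 ≤ α / s ^ 2 * k s := fun s => mul_nonneg (by positivity) (hk0 s)
    refine ⟨k, hk.continuous, hkt, ae_eq_zero_of_radial_subsolution hN hR hR1 hu0 hu ha hk
      (fun s _ => hk₁ s) (fun s _ => hk₂ s) hk0 hksupp (fun s _ => ?_) fun s _ hs => ?_⟩
    · linarith [hkn s, hαk s]
    · linarith [hkp s hs, hαk s]
  · intro hc' hα'
    refine hlocal fun t ht => ?_
    obtain ⟨g, g₁, g₂, a, b, ha, hg, hg₁, hg₂, hg0, hgsupp, hgt, hgn, hgp⟩ :=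
      exists_bump_deriv_add_inv_sq_mul_nonneg hα' hlogR ht
    have h0 : c - ((N : ℝ) - 2) ^ 2 / 4 = 0 := sub_eq_zero.2 hc'
    refine ⟨g, hg.continuous, hgt, ae_eq_zero_of_radial_subsolution hN hR hR1 hu0 hu ha hg
      hg₁ hg₂ hg0 hgsupp ?_ ?_⟩
    · simpa only [h0, zero_add] using hgn
    · simpa only [h0, zero_add] using hgp
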